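/- **Setting.** Let $\mathbb R^d\equiv\mathbb R^{d_1}\times\cdots\times\mathbb R^{d_n}$ with $d=d_1+\cdots+d_n$, write $\xi_k=\mathrm{pr}_k(\xi)\in\mathbb R^{d_k}$ for the $k$-th block of $\xi\in\mathbb R^d$, and let each $\mathbb R^{d_k}$ carry an arbitrary norm $\|\cdot\|$ with dual norm $\|z\|_*:=\sup_{\|v\|\le1}\langle z,v\rangle$. Let $\Xi:=\{\xi\in\mathbb R^d: C\xi\preceq h\}$ be compact, where $C\in\mathbb R^{q\times d}$, $h\in\mathbb R^q$ and $\preceq$ is componentwise. Let $Q=\sum_{l=1}^M\vartheta_l\delta_{\xi^l}$ with $\xi^l\in\Xi$, $\vartheta_l\ge0$, $\sum_l\vartheta_l=1$, and let $\boldsymbol\varepsilon=(\varepsilon_1,\dots,\varepsilon_n)\succeq0$. Let $\mathcal T_1(Q,\boldsymbol\varepsilon)$ be the multi-transport hyperrectangle, i.e. the set of second marginals of all probability distributions $\pi$ on $\Xi\times\Xi$ that have first marginal $Q$ and satisfy $$\int_{\Xi\times\Xi}\|\zeta_k-\xi_k\|\,d\pi(\zeta,\xi)\le\varepsilon_k,\qquad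 k=1,\dots,n.$$ Let $\mathcal X\subset\mathbb R^\ell$ be closed and convex. **(1) One constraint.** Let $m\ge1$, $\alpha\in(0,1)$ and $f(x,\xi):=\max_{1\le j\le m}\big(\langle x,A_j\xi\rangle+b_j(x)\big)$, where $A_j\in\mathbb R^{\ell\times d}$ and each $b_j:\mathbb R^\ell\to\mathbb R$ is convex. Then the distributionally robust CVaR feasible set $$\Big\{x\in\mathcal X:\ \sup_{P\in\mathcal T_1(Q,\boldsymbol\varepsilon)}\ \inf_{\tau\in\mathbb R}\ \mathbb E_P\big[(f(x,\xi)+\tau)_+-\tau\alpha\big]\le0\Big\}$$ consists of all $x\in\mathcal X$ for which there exist $\tau\in\mathbb R$, $\boldsymbol\lambda\in\mathbb R^n$ with $\boldsymbol\lambda\succeq0$, $s_l\ge0$ and $\eta_{lj}\in\mathbb R^q$ with $\eta_{lj}\succeq0$ ($l\le M$, $j\le m$) such that $$\langle\boldsymbol\lambda,\boldsymbol\varepsilon\rangle+\sum_{l=1}^M\vartheta_ls_l\le\tau\alpha,$$ $$b_j(x)+\tau+\langle A_j^\top x-C^\top\eta_{lj},\xi^l\rangle+\langle\eta_{lj},h\rangle\le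 s_l,\qquad l\le M,\ j\le m,$$ $$\big\|\mathrm{pr}_k(A_j^\top x-C^\top\eta_{lj})\big\|_*\le\lambda_k,\qquad l\le M,\ j\le m,\ k\le n.$$ Moreover, for each of these inequalities (including the sign constraints), the left-hand side minus the right-hand side, written in the form "$\le 0$", is jointly convex in $(x,\tau,\boldsymbol\lambda,s,\eta)$. **(2) Several constraints.** Let $I\in\mathbb N$, $m\ge1$, $g\in\mathbb R^\ell$, $\alpha_i\in(0,1)$ and $f_i(x,\xi):=\max_{1\le j\le m}\big(\langle x,A_{ji}\xi\rangle+b_{ji}(x)\big)$ with $A_{ji}\in\mathbb R^{\ell\times d}$ and $b_{ji}:\mathbb R^\ell\to\mathbb R$ convex. Consider the problem $$\inf_{x\in\mathcal X}\ \langle g,x\rangle\quad\text{s.t.}\quad \sup_{P\in\mathcal T_1(Q,\boldsymbol\varepsilon)}\ \inf_{\tau\in\mathbb R}\ \mathbb E_P\big[(f_i(x,\xi)+\tau)_+-\tau\alpha_i\big]\le0,\quad i=1,\dots,I,$$ and the problem of minimizing $\langle g,x\rangle$ over all $x\in\mathcal X$ and $\tau_i\in\mathbb R$, $\boldsymbol\lambda_i\succeq0$,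 $s_{li}\ge0$, $\eta_{lji}\succeq0$ subject to $$\langle\boldsymbol\lambda_i,\boldsymbol\varepsilon\rangle+\sum_{l=1}^M\vartheta_ls_{li}\le\tau_i\alpha_i,$$ $$b_{ji}(x)+\tau_i+\langle A_{ji}^\top x-C^\top\eta_{lji},\xi^l\rangle+\langle\eta_{lji},h\rangle\le s_{li},$$ $$\big\|\mathrm{pr}_k(A_{ji}^\top x-C^\top\eta_{lji})\big\|_*\le\lambda_{ik}$$ for all $l\le M$, $j\le m$, $i\le I$, $k\le n$. Then the second problem is a convex optimization problem (all its constraint functions are jointly convex, its feasible set is convex, its objective is linear), and the two problems are equivalent: the projection of the feasible set of the second onto the $x$-coordinates is the feasible set of the first, the optimal values in $[-\infty,+\infty]$ coincide, and $x$ is an optimal solution of the first if and only if it is the $x$-component of an optimal solution of the second. -/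

import Mathlib

open MeasureTheory
open scoped Matrix

noncomputable section

/-- `ℝ^d ≡ ℝ^{d₁} × ⋯ × ℝ^{dₙ}`: coordinates are indexed by pairs `(k, i)` with `k ∈ [n]`,
`i ∈ [d_k]`. -/
abbrev BlockVec {n : ℕ} (d : Fin n → ℕ) : Type := ((k : Fin n) × Fin (d k)) → ℝ

/-- The projection `pr_k^d` of `ℝ^d` onto its `k`-th block `ℝ^{d_k}`. -/
def blockProj {n : ℕ} {d : Fin n → ℕ} (k : Fin n) (z : BlockVec d) : Fin (d k) → ℝ :=
  fun i => z ⟨k, i⟩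

/-- The dual norm `‖z‖_* = sup { ⟨z, v⟩ : ‖v‖ ≤ 1 }`. -/
def dualNorm {r : ℕ} (N : Seminorm ℝ (Fin r → ℝ)) (z : Fin r → ℝ) : ℝ :=
  sSup {t : ℝ | ∃ v : Fin r → ℝ, N v ≤ 1 ∧ t = z ⬝ᵥ v}

/-- The polyhedron `{ξ : C ξ ≤ h}`, with the componentwise order. -/
def polyhedron {ι : Type} [Fintype ι] {q : ℕ} (C : Matrix (Fin q) ι ℝ) (h : Fin q → ℝ) :
    Set (ι → ℝ) :=
  {ξ | ∀ i, (C *ᵥ ξ) i ≤ h i}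

/-- The discrete distribution `∑ l, ϑ_l δ_{ξ^l}`. -/
def discreteMeasure {Ω : Type} [MeasurableSpace Ω] {M : ℕ} (ϑ : Fin M → ℝ) (ξ : Fin M → Ω) :
    Measure Ω :=
  ∑ l, ENNReal.ofReal (ϑ l) • Measure.dirac (ξ l)

/-- The multi-transport hyperrectangle `𝒯_p(Q, ε)` on `Ξ ⊆ ℝ^d`: the second marginals of all
distributions `π` on `Ξ × Ξ` whose first marginal is `Q` and for which
`∫ ‖ζ_k - ξ_k‖^p dπ(ζ, ξ) ≤ ε_k^p` for every `k`. -/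
def multiTransportHyperrectangle {n : ℕ} {d : Fin n → ℕ} (p : ℝ)
    (N : (k : Fin n) → Seminorm ℝ (Fin (d k) → ℝ)) (Ξ : Set (BlockVec d))
    (Q : Measure Ξ) (ε : Fin n → ℝ) : Set (ProbabilityMeasure Ξ) :=
  {P | ∃ π : ProbabilityMeasure (Ξ × Ξ),
    (π : Measure (Ξ × Ξ)).map Prod.fst = Q ∧
    (π : Measure (Ξ × Ξ)).map Prod.snd = (P : Measure Ξ) ∧
    ∀ k, ∫⁻ w, ENNReal.ofReal
        (N k (blockProj k (w.1 : BlockVec d) - blockProj k (w.2 : BlockVec d)) ^ p)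
      ∂(π : Measure (Ξ × Ξ)) ≤ ENNReal.ofReal (ε k ^ p)}

/-- `sup_{P ∈ 𝒜} inf_{τ ∈ ℝ} E_P[(φ + τ)₊ - τ α]`, as an extended real number. -/
def worstCaseCVaR {Ω : Type} [MeasurableSpace Ω] (𝒜 : Set (ProbabilityMeasure Ω))
    (φ : Ω → ℝ) (α : ℝ) : EReal :=
  ⨆ P ∈ 𝒜, ⨅ τ : ℝ, ((∫ ξ, (max (φ ξ + τ) 0 - τ * α) ∂(P : Measure Ω) : ℝ) : EReal)

/-- `f(x, ξ) = max_j (⟨x, A_j ξ⟩ + b_j(x))`. -/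
def maxAffine {ι : Type} [Fintype ι] {ℓ m : ℕ} [NeZero m] (A : Fin m → Matrix (Fin ℓ) ι ℝ)
    (b : Fin m → (Fin ℓ → ℝ) → ℝ) (x : Fin ℓ → ℝ) (ξ : ι → ℝ) : ℝ :=
  Finset.univ.sup' Finset.univ_nonempty fun j => x ⬝ᵥ (A j *ᵥ ξ) + b j x

/-- The set of `x ∈ 𝒳` with `sup_{P ∈ 𝒯₁(Q, ε)} inf_τ E_P[(f(x, ξ) + τ)₊ - τ α] ≤ 0`. -/
def cvarFeasibleSet {n : ℕ} {d : Fin n → ℕ} (N : (k : Fin n) → Seminorm ℝ (Fin (d k) → ℝ))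
    (Ξ : Set (BlockVec d)) (Q : Measure Ξ) (ε : Fin n → ℝ) {ℓ : ℕ} (𝒳 : Set (Fin ℓ → ℝ))
    (f : (Fin ℓ → ℝ) → BlockVec d → ℝ) (α : ℝ) : Set (Fin ℓ → ℝ) :=
  {x ∈ 𝒳 | worstCaseCVaR (multiTransportHyperrectangle 1 N Ξ Q ε) (fun ξ => f x ξ) α ≤ 0}

/-- The auxiliary variables `(τ, λ, s, η)` of one reformulated constraint. -/
abbrev AuxVars (n M m q : ℕ) : Type :=
  ℝ × (Fin n → ℝ) × (Fin M → ℝ) × (Fin M → Fin m → Fin q → ℝ)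

/-- Labels of the scalar inequalities of one reformulated constraint. -/
inductive ConstraintLabel (n M m q : ℕ) : Type
  | budget : ConstraintLabel n M m q
  | epigraph (l : Fin M) (j : Fin m) : ConstraintLabel n M m q
  | dualBound (l : Fin M) (j : Fin m) (k : Fin n) : ConstraintLabel n M m q
  | lamNonneg (k : Fin n) : ConstraintLabel n M m q
  | sNonneg (l : Fin M) : ConstraintLabel n M m q
  | etaNonneg (l : Fin M) (j : Fin m) (i : Fin q) : ConstraintLabel n M m q

/-- The left-hand side minus the right-hand side of each inequality:
* `⟨λ, ε⟩ + ∑ l, ϑ_l s_l ≤ τ α`;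
* `b_j(x) + τ + ⟨A_jᵀ x - Cᵀ η_lj, ξ^l⟩ + ⟨η_lj, h⟩ ≤ s_l`;
* `‖pr_k (A_jᵀ x - Cᵀ η_lj)‖_* ≤ λ_k`;
* `0 ≤ λ_k`, `0 ≤ s_l` and `0 ≤ (η_lj)_i`. -/
def reformConstraint {n : ℕ} {d : Fin n → ℕ} {q M ℓ m : ℕ}
    (N : (k : Fin n) → Seminorm ℝ (Fin (d k) → ℝ)) (ε : Fin n → ℝ)
    (C : Matrix (Fin q) ((k : Fin n) × Fin (d k)) ℝ) (h : Fin q → ℝ)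
    (ϑ : Fin M → ℝ) (ξ : Fin M → BlockVec d)
    (A : Fin m → Matrix (Fin ℓ) ((k : Fin n) × Fin (d k)) ℝ)
    (b : Fin m → (Fin ℓ → ℝ) → ℝ) (α : ℝ) :
    ConstraintLabel n M m q → (Fin ℓ → ℝ) × AuxVars n M m q → ℝ
  | .budget, (_, τ, lam, s, _) => (lam ⬝ᵥ ε + ∑ l, ϑ l * s l) - τ * α
  | .epigraph l j, (x, τ, _, s, η) =>
      (b j x + τ + ((A j)ᵀ *ᵥ x - Cᵀ *ᵥ η l j) ⬝ᵥ ξ l + η l j ⬝ᵥ h) - s l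
  | .dualBound l j k, (x, _, lam, _, η) =>
      dualNorm (N k) (blockProj k ((A j)ᵀ *ᵥ x - Cᵀ *ᵥ η l j)) - lam k
  | .lamNonneg k, (_, _, lam, _, _) => -lam k
  | .sNonneg l, (_, _, _, s, _) => -s l
  | .etaNonneg l j i, (_, _, _, _, η) => -η l j i

end

/-! The matter reduces to one worst-case CVaR constraint at fixed `x`, where `f` is a maximum of
affine functions `⟨a_j, ·⟩ + β_j`. The claim is a strong duality theorem with attained multipliers.

Multipliers suffice (`worstCaseCVaR_nonpos_of_multipliers`): they bound `(f(ξ) + τ)₊` by a function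
of the starting point `ζ` plus `∑ λ_k ‖ζ_k - ξ_k‖`. Integrating against a transport plan turns the
first term into at most `∑ ϑ_l s_l` and the second into at most `⟨λ, ε⟩`, so this single `τ` makes
the expectation nonpositive.

Multipliers exist: restrict the supremum to plans that move mass `p_lj` from `ξ^l` to one point for
each affine piece `j`, with total moved mass `∑ p_lj = α`. For such plans `τ` cancels, so the
infimum over `τ` is bounded below by a linear function of `p` and of the displacements `v_lj`
multiplied by mass (`primal_value_nonpos`). No minimax exchange is needed: `τ` returns as the
negative of the multiplier of `∑ p_lj = α`. The program in `(p, v)` has polyhedral constraints and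
norm budgets. Hahn-Banach separation handles the budgets and Farkas' lemma the polyhedral part
(`exists_multipliers_of_nonpos`), and the support function of the budget set produces the dual norms
(`sum_mul_dualNorm_le_of_support`).

Several constraints decouple because each has its own auxiliary variables. -/

/-! ### Farkas' lemma and its affine versions. -/

/-- **Farkas' lemma** for finitely many linear functionals on a real vector space. -/
theorem farkas_linear {E ι : Type*} [AddCommGroup E] [Module ℝ E] (t : Finset ι) :
    ∀ (f : ι → E →ₗ[ℝ] ℝ) (c : E →ₗ[ℝ] ℝ), (∀ x, (∀ i ∈ t, f i x ≤ 0) → c x ≤ 0) →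
      ∃ y : ι → ℝ, (∀ i, 0 ≤ y i) ∧ ∀ x, c x = ∑ i ∈ t, y i * f i x := by
  classical
  induction t using Finset.induction_on with
  | empty =>
    intro f c hc
    refine ⟨0, fun _ => le_rfl, fun x => ?_⟩
    have h1 := hc x (by simp)
    have h2 := hc (-x) (by simp)
    rw [map_neg] at h2
    simp only [Finset.sum_empty]
    linarith
  | insert a t ha ih =>
    intro f c hc
    by_cases hall : ∀ x, (∀ i ∈ t, f i x ≤ 0) → c x ≤ 0
    · obtain ⟨y, hy, hcy⟩ := ih f c hall
      refine ⟨Function.update y a 0, fun i => ?_, fun x => ?_⟩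
      · by_cases hi : i = a
        · simp [hi]
        · simpa [hi] using hy i
      · rw [Finset.sum_insert ha, hcy x]
        simp only [Function.update_self, zero_mul, zero_add]
        refine Finset.sum_congr rfl fun i hi => ?_
        rw [Function.update_of_ne (ne_of_mem_of_not_mem hi ha)]
    · push Not at hall
      obtain ⟨x₀, hx₀, hcx₀⟩ := hall
      have hfa : 0 < f a x₀ := by
        by_contra hneg
        push Not at hneg
        refine absurd (hc x₀ fun i hi => ?_) (not_le.2 hcx₀)
        rcases Finset.mem_insert.1 hi with rfl | hi
        exacts [hneg, hx₀ i hi]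
      -- These functionals are `f i` and `c` composed with the projection along `x₀` onto the kernel
      -- of `f a`; there the constraint `a` holds trivially and the induction hypothesis applies.
      obtain ⟨y, hy, hcy⟩ := ih (fun i => f i - (f i x₀ / f a x₀) • f a)
        (c - (c x₀ / f a x₀) • f a) (by
          intro x hx
          have := hc (x - (f a x / f a x₀) • x₀) (by
            intro i hi
            rcases Finset.mem_insert.1 hi with rfl | hi
            · simp only [map_sub, map_smul, smul_eq_mul]
              rw [div_mul_cancel₀ _ hfa.ne', sub_self]
            · have := hx i hi
              simp only [map_sub, map_smul, smul_eq_mul, LinearMap.sub_apply,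
                LinearMap.smul_apply] at this ⊢
              convert this using 2
              ring)
          simp only [map_sub, map_smul, smul_eq_mul, LinearMap.sub_apply,
            LinearMap.smul_apply] at this ⊢
          convert this using 2
          ring)
      have hsum : ∑ i ∈ t, y i * f i x₀ ≤ 0 :=
        Finset.sum_nonpos fun i hi => mul_nonpos_of_nonneg_of_nonpos (hy i) (hx₀ i hi)
      refine ⟨Function.update y a ((c x₀ - ∑ i ∈ t, y i * f i x₀) / f a x₀), fun i => ?_,
        fun x => ?_⟩
      · by_cases hi : i = a
        · subst hi
          simp only [Function.update_self]
          exact div_nonneg (by linarith) hfa.le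
        · simpa [hi] using hy i
      · have h1 := hcy x
        simp only [LinearMap.sub_apply, LinearMap.smul_apply, smul_eq_mul] at h1
        have h2 : ∑ i ∈ t, y i * (f i x - f i x₀ / f a x₀ * f a x) =
            ∑ i ∈ t, y i * f i x - (∑ i ∈ t, y i * f i x₀) / f a x₀ * f a x := by
          rw [Finset.sum_div, Finset.sum_mul, ← Finset.sum_sub_distrib]
          refine Finset.sum_congr rfl fun i _ => ?_
          ring
        have h3 : ∑ i ∈ t, Function.update y a
            ((c x₀ - ∑ i ∈ t, y i * f i x₀) / f a x₀) i * f i x = ∑ i ∈ t, y i * f i x := by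
          refine Finset.sum_congr rfl fun i hi => ?_
          rw [Function.update_of_ne (ne_of_mem_of_not_mem hi ha)]
        rw [Finset.sum_insert ha, h3, Function.update_self]
        rw [h2] at h1
        rw [sub_div, sub_mul]
        linarith

/-- Affine Farkas lemma: an affine inequality valid on a nonempty polyhedron is a nonnegative
combination of the inequalities defining it. -/
theorem farkas_affine {E ι : Type*} [AddCommGroup E] [Module ℝ E] [Fintype ι]
    (f : ι → E →ₗ[ℝ] ℝ) (b : ι → ℝ) (c : E →ₗ[ℝ] ℝ) (δ : ℝ) (x₀ : E) (hx₀ : ∀ i, f i x₀ ≤ b i)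
    (hc : ∀ x, (∀ i, f i x ≤ b i) → c x ≤ δ) :
    ∃ y : ι → ℝ, (∀ i, 0 ≤ y i) ∧ (∀ x, c x = ∑ i, y i * f i x) ∧ ∑ i, y i * b i ≤ δ := by
  -- Homogenization by an extra variable `t ≥ 0`, whose constraint is indexed by `none`.
  obtain ⟨y, hy, hcy⟩ := farkas_linear (E := E × ℝ) (Finset.univ : Finset (Option ι))
    (fun o => o.elim (-LinearMap.snd ℝ E ℝ)
      (fun i => f i ∘ₗ LinearMap.fst ℝ E ℝ - b i • LinearMap.snd ℝ E ℝ))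
    (c ∘ₗ LinearMap.fst ℝ E ℝ - δ • LinearMap.snd ℝ E ℝ) (by
      rintro ⟨x, t⟩ hx
      have ht : 0 ≤ t := by simpa using hx none (Finset.mem_univ _)
      have hf : ∀ i, f i x ≤ b i * t := fun i => by
        simpa using hx (some i) (Finset.mem_univ _)
      suffices c x ≤ δ * t by simpa using this
      rcases ht.eq_or_lt with rfl | ht
      -- At `t = 0` the vector `x` is a recession direction; if `c x > 0`, moving far enough from
      -- `x₀` along it would violate the bound `δ`.
      · simp only [mul_zero] at hf ⊢
        by_contra! hpos
        have hcx₀ := hc x₀ hx₀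
        have := hc (x₀ + ((δ - c x₀ + 1) / c x) • x) (fun i => by
          simp only [map_add, map_smul, smul_eq_mul]
          have := mul_nonpos_of_nonneg_of_nonpos
            (div_nonneg (by linarith : 0 ≤ δ - c x₀ + 1) hpos.le) (hf i)
          linarith [hx₀ i])
        simp only [map_add, map_smul, smul_eq_mul] at this
        rw [div_mul_cancel₀ _ hpos.ne'] at this
        linarith
      · have := hc (t⁻¹ • x) (fun i => by
          simp only [map_smul, smul_eq_mul]
          rw [inv_mul_le_iff₀ ht, mul_comm]
          exact hf i)
        simp only [map_smul, smul_eq_mul] at this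
        rw [inv_mul_le_iff₀ ht] at this
        linarith)
  refine ⟨fun i => y (some i), fun i => hy _, fun x => ?_, ?_⟩
  · simpa using hcy (x, 0)
  · have := hcy (0, 1)
    simp only [Fintype.sum_option] at this
    simp at this
    have h0 := hy none
    linarith

/-- Affine Farkas lemma with equality constraints. -/
theorem farkas_affine_eq {E ι κ : Type*} [AddCommGroup E] [Module ℝ E] [Fintype ι] [Fintype κ]
    (f : ι → E →ₗ[ℝ] ℝ) (b : ι → ℝ) (g : κ → E →ₗ[ℝ] ℝ) (e : κ → ℝ) (c : E →ₗ[ℝ] ℝ) (δ : ℝ)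
    (x₀ : E) (hx₀ : ∀ i, f i x₀ ≤ b i) (hg₀ : ∀ j, g j x₀ = e j)
    (hc : ∀ x, (∀ i, f i x ≤ b i) → (∀ j, g j x = e j) → c x ≤ δ) :
    ∃ (y : ι → ℝ) (w : κ → ℝ), (∀ i, 0 ≤ y i) ∧
      (∀ x, c x = ∑ i, y i * f i x + ∑ j, w j * g j x) ∧
      ∑ i, y i * b i + ∑ j, w j * e j ≤ δ := by
  obtain ⟨y, hy, hcy, hyb⟩ := farkas_affine (ι := ι ⊕ (κ ⊕ κ))
    (Sum.elim f (Sum.elim g fun j => -g j)) (Sum.elim b (Sum.elim e fun j => -e j)) c δ x₀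
    (by rintro (i | j | j) <;> simp [hx₀, hg₀]) (by
      intro x hx
      refine hc x (fun i => hx (Sum.inl i)) fun j => le_antisymm (hx (Sum.inr (Sum.inl j))) ?_
      simpa using hx (Sum.inr (Sum.inr j)))
  refine ⟨fun i => y (Sum.inl i), fun j => y (Sum.inr (Sum.inl j)) - y (Sum.inr (Sum.inr j)),
    fun i => hy _, fun x => ?_, ?_⟩
  · rw [hcy x]
    simp [Fintype.sum_sum_type, sub_mul, Finset.sum_sub_distrib, ← sub_eq_add_neg]
  · simpa [Fintype.sum_sum_type, sub_mul, Finset.sum_sub_distrib, ← sub_eq_add_neg] using hyb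

/-! ### Dual norms in finite dimension. -/

section DualNorm

variable {r : ℕ} {N : Seminorm ℝ (Fin r → ℝ)}

theorem Seminorm.continuous_pi_fin (N : Seminorm ℝ (Fin r → ℝ)) : Continuous N :=
  N.convexOn.locallyLipschitz.continuous

/-- A definite seminorm has a positive minimum on the compact unit sphere. The sphere is empty when
`r = 0`, which needs a separate case. -/
theorem exists_norm_le_mul_seminorm (hN : ∀ v, N v = 0 → v = 0) :
    ∃ K : ℝ, 0 < K ∧ ∀ v, ‖v‖ ≤ K * N v := by
  rcases (Metric.sphere (0 : Fin r → ℝ) 1).eq_empty_or_nonempty with he | hne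
  · refine ⟨1, one_pos, fun v => ?_⟩
    by_cases hv : v = 0
    · simp [hv]
    · have : ‖v‖⁻¹ • v ∈ Metric.sphere (0 : Fin r → ℝ) 1 := by
        simp [norm_smul, hv]
      simp [he] at this
  · obtain ⟨v₀, hv₀, hmin⟩ := (isCompact_sphere (0 : Fin r → ℝ) 1).exists_isMinOn hne
      N.continuous_pi_fin.continuousOn
    have hv₀0 : v₀ ≠ 0 := by rintro rfl; simp at hv₀
    have hpos : 0 < N v₀ :=
      lt_of_le_of_ne (apply_nonneg N v₀) fun h => hv₀0 (hN _ h.symm)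
    refine ⟨(N v₀)⁻¹, inv_pos.2 hpos, fun v => ?_⟩
    by_cases hv : v = 0
    · simp [hv]
    · have hvn : 0 < ‖v‖ := norm_pos_iff.2 hv
      have : N v₀ ≤ N (‖v‖⁻¹ • v) := hmin (by simp [norm_smul, hv])
      rw [map_smul_eq_mul, norm_inv, norm_norm, le_inv_mul_iff₀ hvn] at this
      rwa [le_inv_mul_iff₀ hpos, mul_comm]

/-- The unit ball is compact, so the supremum is attained; in particular `sSup` never takes its
default value for unbounded sets. -/
theorem exists_dualNorm_eq (hN : ∀ v, N v = 0 → v = 0) (z : Fin r → ℝ) :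
    ∃ v, N v ≤ 1 ∧ z ⬝ᵥ v = dualNorm N z ∧ ∀ v', N v' ≤ 1 → z ⬝ᵥ v' ≤ dualNorm N z := by
  obtain ⟨K, hK, hKN⟩ := exists_norm_le_mul_seminorm hN
  have hcomp : IsCompact {v | N v ≤ 1} := by
    refine Metric.isCompact_of_isClosed_isBounded
      (isClosed_le N.continuous_pi_fin continuous_const) ?_
    refine (Metric.isBounded_closedBall (x := (0 : Fin r → ℝ)) (r := K)).subset fun v hv => ?_
    rw [mem_closedBall_zero_iff]
    exact (hKN v).trans (mul_le_of_le_one_right hK.le hv)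
  obtain ⟨v, hv, hmax⟩ := hcomp.exists_isMaxOn ⟨0, by simp⟩
    (f := fun v => z ⬝ᵥ v) (by fun_prop)
  have hgr : IsGreatest {t : ℝ | ∃ v : Fin r → ℝ, N v ≤ 1 ∧ t = z ⬝ᵥ v} (z ⬝ᵥ v) :=
    ⟨⟨v, hv, rfl⟩, by rintro _ ⟨v', hv', rfl⟩; exact hmax hv'⟩
  have heq : dualNorm N z = z ⬝ᵥ v := hgr.csSup_eq
  exact ⟨v, hv, heq.symm, fun v' hv' => heq ▸ hmax hv'⟩

theorem dualNorm_nonneg (hN : ∀ v, N v = 0 → v = 0) (z : Fin r → ℝ) : 0 ≤ dualNorm N z := by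
  obtain ⟨_, _, _, h⟩ := exists_dualNorm_eq hN z
  simpa using h 0 (by simp)

theorem dotProduct_le_dualNorm_mul (hN : ∀ v, N v = 0 → v = 0) (z v : Fin r → ℝ) :
    z ⬝ᵥ v ≤ dualNorm N z * N v := by
  obtain ⟨_, _, _, h⟩ := exists_dualNorm_eq hN z
  rcases (apply_nonneg N v).eq_or_lt with h0 | hpos
  · simp [hN v h0.symm]
  · have := h ((N v)⁻¹ • v) (by
      rw [map_smul_eq_mul, norm_inv, Real.norm_of_nonneg hpos.le, inv_mul_cancel₀ hpos.ne'])
    rw [dotProduct_smul, smul_eq_mul, inv_mul_le_iff₀ hpos] at this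
    linarith

theorem dualNorm_convexOn (hN : ∀ v, N v = 0 → v = 0) : ConvexOn ℝ Set.univ (dualNorm N) := by
  refine ⟨convex_univ, fun z _ z' _ s t hs ht _ => ?_⟩
  obtain ⟨v, hv, hveq, _⟩ := exists_dualNorm_eq hN (s • z + t • z')
  obtain ⟨_, _, _, h⟩ := exists_dualNorm_eq hN z
  obtain ⟨_, _, _, h'⟩ := exists_dualNorm_eq hN z'
  rw [← hveq, add_dotProduct, smul_dotProduct, smul_dotProduct]
  exact add_le_add (smul_le_smul_of_nonneg_left (h v hv) hs)
    (smul_le_smul_of_nonneg_left (h' v hv) ht)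

end DualNorm

theorem dotProduct_eq_sum_blockProj {n : ℕ} {d : Fin n → ℕ} (z v : BlockVec d) :
    z ⬝ᵥ v = ∑ k, blockProj k z ⬝ᵥ blockProj k v := by
  simp only [dotProduct, Fintype.sum_sigma, blockProj]

theorem maxAffine_eq {ι : Type} [Fintype ι] {ℓ m : ℕ} [NeZero m] (A : Fin m → Matrix (Fin ℓ) ι ℝ)
    (b : Fin m → (Fin ℓ → ℝ) → ℝ) (x : Fin ℓ → ℝ) (ξ : ι → ℝ) :
    maxAffine A b x ξ =
      Finset.univ.sup' Finset.univ_nonempty fun j => ((A j)ᵀ *ᵥ x) ⬝ᵥ ξ + b j x := by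
  simp only [maxAffine, Matrix.mulVec_transpose, Matrix.dotProduct_mulVec]

/-! ### Finitely supported measures. -/

section FiniteSupport

variable {Ω κ : Type} [MeasurableSpace Ω] [Fintype κ]

theorem integral_finsetSum_dirac [MeasurableSingletonClass Ω] {w : κ → ℝ} (hw : ∀ i, 0 ≤ w i)
    (x : κ → Ω) (f : Ω → ℝ) :
    ∫ ω, f ω ∂(∑ i, ENNReal.ofReal (w i) • Measure.dirac (x i)) = ∑ i, w i * f (x i) := by
  rw [integral_finsetSum_measure fun i _ =>
    (integrable_dirac (by simp)).smul_measure ENNReal.ofReal_ne_top]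
  refine Finset.sum_congr rfl fun i _ => ?_
  rw [integral_smul_measure, integral_dirac, ENNReal.toReal_ofReal (hw i), smul_eq_mul]

theorem lintegral_finsetSum_dirac [MeasurableSingletonClass Ω] {w : κ → ℝ}
    (x : κ → Ω) (f : Ω → ENNReal) :
    ∫⁻ ω, f ω ∂(∑ i, ENNReal.ofReal (w i) • Measure.dirac (x i)) =
      ∑ i, ENNReal.ofReal (w i) * f (x i) := by
  rw [lintegral_finsetSum_measure]
  refine Finset.sum_congr rfl fun i _ => ?_
  rw [lintegral_smul_measure, lintegral_dirac, smul_eq_mul]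

theorem map_finsetSum_dirac {Ω' : Type} [MeasurableSpace Ω'] {w : κ → ℝ} (x : κ → Ω) {f : Ω → Ω'}
    (hf : Measurable f) :
    (∑ i, ENNReal.ofReal (w i) • Measure.dirac (x i)).map f =
      ∑ i, ENNReal.ofReal (w i) • Measure.dirac (f (x i)) := by
  rw [Measure.map_finset_sum hf.aemeasurable]
  refine Finset.sum_congr rfl fun i _ => ?_
  rw [Measure.map_smul, Measure.map_dirac' hf]

theorem isProbabilityMeasure_finsetSum_dirac {w : κ → ℝ} (hw : ∀ i, 0 ≤ w i) (hw1 : ∑ i, w i = 1)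
    (x : κ → Ω) :
    IsProbabilityMeasure (∑ i, ENNReal.ofReal (w i) • Measure.dirac (x i)) := by
  constructor
  simp only [Measure.coe_finsetSum, Finset.sum_apply, Measure.smul_apply, measure_univ,
    smul_eq_mul, mul_one]
  rw [← ENNReal.ofReal_sum_of_nonneg fun i _ => hw i, hw1, ENNReal.ofReal_one]

end FiniteSupport

theorem Continuous.integrable_of_compactSpace {Ω : Type} [TopologicalSpace Ω] [CompactSpace Ω]
    [MeasurableSpace Ω] [OpensMeasurableSpace Ω] {μ : Measure Ω} [IsFiniteMeasure μ]
    {f : Ω → ℝ} (hf : Continuous f) : Integrable f μ :=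
  BoundedContinuousFunction.integrable μ (BoundedContinuousFunction.mkOfCompact ⟨f, hf⟩)

/-! ### Weak duality: multipliers bound the worst case. -/

section WeakDuality

variable {n : ℕ} {d : Fin n → ℕ} {N : (k : Fin n) → Seminorm ℝ (Fin (d k) → ℝ)}
  {q : ℕ} {C : Matrix (Fin q) ((k : Fin n) × Fin (d k)) ℝ} {h : Fin q → ℝ}

theorem continuous_blockProj (k : Fin n) : Continuous (blockProj (d := d) k) := by
  unfold blockProj
  fun_prop

/-- Split `a` into `Cᵀ η`, controlled on the polyhedron by `⟨η, h⟩`, and a remainder, whose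
increment from `ζ` to `ξ` is estimated block by block with dual norms. -/
theorem dotProduct_le_of_dualNorm_le (hN : ∀ k v, N k v = 0 → v = 0) {a : BlockVec d}
    {η : Fin q → ℝ} (hη : ∀ i, 0 ≤ η i) {lam : Fin n → ℝ}
    (hlam : ∀ k, dualNorm (N k) (blockProj k (a - Cᵀ *ᵥ η)) ≤ lam k)
    (ζ : BlockVec d) {ξ : BlockVec d} (hξ : ξ ∈ polyhedron C h) :
    a ⬝ᵥ ξ ≤ (a - Cᵀ *ᵥ η) ⬝ᵥ ζ + η ⬝ᵥ h +
      ∑ k, lam k * N k (blockProj k ζ - blockProj k ξ) := by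
  have h1 : (Cᵀ *ᵥ η) ⬝ᵥ ξ ≤ η ⬝ᵥ h := by
    rw [Matrix.mulVec_transpose, ← Matrix.dotProduct_mulVec]
    exact Finset.sum_le_sum fun i _ => mul_le_mul_of_nonneg_left (hξ i) (hη i)
  have h2 : (a - Cᵀ *ᵥ η) ⬝ᵥ (ξ - ζ) ≤ ∑ k, lam k * N k (blockProj k ζ - blockProj k ξ) := by
    rw [dotProduct_eq_sum_blockProj]
    refine Finset.sum_le_sum fun k _ => (dotProduct_le_dualNorm_mul (hN k) _ _).trans ?_
    have : N k (blockProj k (ξ - ζ)) = N k (blockProj k ζ - blockProj k ξ) := by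
      rw [← map_neg_eq_map (N k) (blockProj k ζ - blockProj k ξ), neg_sub]
      rfl
    rw [this]
    exact mul_le_mul_of_nonneg_right (hlam k) (apply_nonneg _ _)
  rw [dotProduct_sub, sub_dotProduct] at h2
  linarith

/-- Weak duality: a feasible point of the reformulated constraint certifies that the worst-case
CVaR is nonpositive. -/
theorem worstCaseCVaR_nonpos_of_multipliers (hN : ∀ k v, N k v = 0 → v = 0)
    {ε : Fin n → ℝ} (hε : ∀ k, 0 ≤ ε k) (hΞ : IsCompact (polyhedron C h))
    {M m : ℕ} [NeZero M] [NeZero m] {ϑ : Fin M → ℝ} (hϑ : ∀ l, 0 ≤ ϑ l)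
    (ξ : Fin M → polyhedron C h) (a : Fin m → BlockVec d) (β : Fin m → ℝ) {α τ : ℝ}
    {lam : Fin n → ℝ} (hlam : ∀ k, 0 ≤ lam k) {s : Fin M → ℝ} (hs : ∀ l, 0 ≤ s l)
    {η : Fin M → Fin m → Fin q → ℝ} (hη : ∀ l j i, 0 ≤ η l j i)
    (hbudget : lam ⬝ᵥ ε + ∑ l, ϑ l * s l ≤ τ * α)
    (hepi : ∀ l j, β j + τ + (a j - Cᵀ *ᵥ η l j) ⬝ᵥ (ξ l : BlockVec d) + η l j ⬝ᵥ h ≤ s l)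
    (hdual : ∀ l j k, dualNorm (N k) (blockProj k (a j - Cᵀ *ᵥ η l j)) ≤ lam k) :
    worstCaseCVaR (multiTransportHyperrectangle 1 N (polyhedron C h) (discreteMeasure ϑ ξ) ε)
      (fun ζ => Finset.univ.sup' Finset.univ_nonempty fun j => a j ⬝ᵥ (ζ : BlockVec d) + β j) α
      ≤ 0 := by
  have : CompactSpace (polyhedron C h) := isCompact_iff_compactSpace.1 hΞ
  refine iSup₂_le fun P ⟨π, hπ1, hπ2, hπc⟩ => iInf_le_of_le τ ?_
  rw [← EReal.coe_zero, EReal.coe_le_coe_iff]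
  set φ : polyhedron C h → ℝ := fun ζ =>
    Finset.univ.sup' Finset.univ_nonempty fun j => a j ⬝ᵥ (ζ : BlockVec d) + β j with hφ
  have hφc : Continuous φ := by
    refine Continuous.finset_sup'_apply _ fun j _ => ?_
    fun_prop
  -- The bound given by the `l`-th multipliers holds from every starting point, not only from `ξ l`.
  -- Hence the minimum over `l` is one continuous function of `ζ`, which avoids disintegrating `π`
  -- and allows repeated atoms.
  let S : polyhedron C h → ℝ := fun ζ => Finset.univ.inf' Finset.univ_nonempty fun l =>
    max 0 (Finset.univ.sup' Finset.univ_nonempty fun j =>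
      β j + τ + (a j - Cᵀ *ᵥ η l j) ⬝ᵥ (ζ : BlockVec d) + η l j ⬝ᵥ h)
  have hSc : Continuous S := by
    refine Continuous.finset_inf'_apply _ fun l _ => continuous_const.max ?_
    refine Continuous.finset_sup'_apply _ fun j _ => ?_
    fun_prop
  have hSle : ∀ l, S (ξ l) ≤ s l := fun l =>
    (Finset.inf'_le _ (Finset.mem_univ l)).trans
      (max_le (hs l) (Finset.sup'_le _ _ fun j _ => hepi l j))
  let c : (k : Fin n) → polyhedron C h × polyhedron C h → ℝ := fun k w =>
    N k (blockProj k (w.1 : BlockVec d) - blockProj k (w.2 : BlockVec d))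
  have hcc : ∀ k, Continuous (c k) := fun k =>
    (N k).continuous_pi_fin.comp
      (((continuous_blockProj k).comp (continuous_subtype_val.comp continuous_fst)).sub
        ((continuous_blockProj k).comp (continuous_subtype_val.comp continuous_snd)))
  have hpt : ∀ w : polyhedron C h × polyhedron C h,
      max (φ w.2 + τ) 0 ≤ S w.1 + ∑ k, lam k * c k w := by
    intro w
    have hc0 : 0 ≤ ∑ k, lam k * c k w :=
      Finset.sum_nonneg fun k _ => mul_nonneg (hlam k) (apply_nonneg _ _)
    rw [← sub_le_iff_le_add]
    refine Finset.le_inf' _ _ fun l _ => ?_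
    rw [sub_le_iff_le_add]
    refine max_le ?_ (add_nonneg (le_max_left _ _) hc0)
    rw [← le_sub_iff_add_le]
    refine Finset.sup'_le _ _ fun j _ => ?_
    have h1 := dotProduct_le_of_dualNorm_le hN (hη l j) (hdual l j) w.1 w.2.2
    have h2 := (Finset.le_sup' (fun j => β j + τ + (a j - Cᵀ *ᵥ η l j) ⬝ᵥ (w.1 : BlockVec d) +
      η l j ⬝ᵥ h) (Finset.mem_univ j)).trans (le_max_right 0 _)
    change a j ⬝ᵥ (w.2 : BlockVec d) + β j ≤ _
    linarith
  have hcint : ∀ k, ∫ w, c k w ∂(π : Measure _) ≤ ε k := by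
    intro k
    have := hπc k
    simp only [Real.rpow_one] at this
    rw [integral_eq_lintegral_of_nonneg_ae (ae_of_all _ fun w => apply_nonneg _ _)
      (hcc k).aestronglyMeasurable]
    exact ENNReal.toReal_le_of_le_ofReal (hε k) this
  have hSint : ∫ w, S w.1 ∂(π : Measure (polyhedron C h × polyhedron C h)) ≤
      ∑ l, ϑ l * s l := by
    rw [← integral_map (φ := Prod.fst) (f := S) measurable_fst.aemeasurable
      hSc.aestronglyMeasurable, hπ1, discreteMeasure, integral_finsetSum_dirac hϑ]
    exact Finset.sum_le_sum fun l _ => mul_le_mul_of_nonneg_left (hSle l) (hϑ l)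
  have hsplit : ∫ ζ, (max (φ ζ + τ) 0 - τ * α) ∂(P : Measure (polyhedron C h)) =
      ∫ w, max (φ w.2 + τ) 0 ∂(π : Measure (polyhedron C h × polyhedron C h)) - τ * α := by
    rw [integral_sub (by apply Continuous.integrable_of_compactSpace; fun_prop)
      (integrable_const _), ← hπ2,
      integral_map measurable_snd.aemeasurable
        (by apply Continuous.aestronglyMeasurable; fun_prop)]
    rw [hπ2]
    simp
  have hle : ∫ w, max (φ w.2 + τ) 0 ∂(π : Measure (polyhedron C h × polyhedron C h)) ≤
      ∫ w, S w.1 + ∑ k, lam k * c k w ∂(π : Measure (polyhedron C h × polyhedron C h)) :=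
    integral_mono (by apply Continuous.integrable_of_compactSpace; fun_prop)
      (by apply Continuous.integrable_of_compactSpace; fun_prop) hpt
  rw [integral_add (by apply Continuous.integrable_of_compactSpace; fun_prop)
    (by apply Continuous.integrable_of_compactSpace; fun_prop),
    integral_finsetSum _ fun k _ => by apply Continuous.integrable_of_compactSpace; fun_prop]
    at hle
  simp only [integral_const_mul] at hle
  have hlamc : ∑ k, lam k * ∫ w, c k w ∂(π : Measure _) ≤ lam ⬝ᵥ ε :=
    Finset.sum_le_sum fun k _ => mul_le_mul_of_nonneg_left (hcint k) (hlam k)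
  rw [hsplit]
  linarith

end WeakDuality

/-! ### From the finite-dimensional program to transport plans. -/

/-- A nonempty bounded polyhedron has trivial recession cone. -/
theorem eq_zero_of_mulVec_nonpos {ι : Type} [Fintype ι] {q : ℕ} {C : Matrix (Fin q) ι ℝ}
    {h : Fin q → ℝ} (hΞ : IsCompact (polyhedron C h)) {ξ : ι → ℝ} (hξ : ξ ∈ polyhedron C h)
    {v : ι → ℝ} (hv : ∀ i, (C *ᵥ v) i ≤ 0) : v = 0 := by
  obtain ⟨R, hR⟩ := hΞ.isBounded.exists_norm_le
  by_contra hne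
  have hpos : 0 < ‖v‖ := norm_pos_iff.2 hne
  have hR0 : 0 ≤ R := (norm_nonneg _).trans (hR ξ hξ)
  have hmem : ξ + ((2 * R + 1) / ‖v‖) • v ∈ polyhedron C h := fun i => by
    rw [Matrix.mulVec_add, Matrix.mulVec_smul, Pi.add_apply, Pi.smul_apply, smul_eq_mul]
    have := mul_nonpos_of_nonneg_of_nonpos (by positivity : 0 ≤ (2 * R + 1) / ‖v‖) (hv i)
    linarith [hξ i]
  have h1 := norm_sub_le (ξ + ((2 * R + 1) / ‖v‖) • v) ξ
  rw [add_sub_cancel_left, norm_smul, Real.norm_of_nonneg (by positivity),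
    div_mul_cancel₀ _ hpos.ne'] at h1
  linarith [hR _ hmem, hR _ hξ]

/-- Recovers a destination from a displacement scaled by mass. For `p = 0` the vector `v` is a
recession direction, so compactness forces `v = 0`. -/
theorem exists_mem_polyhedron_smul_sub {ι : Type} [Fintype ι] {q : ℕ} {C : Matrix (Fin q) ι ℝ}
    {h : Fin q → ℝ} (hΞ : IsCompact (polyhedron C h)) (ξ : polyhedron C h) {p : ℝ} (hp : 0 ≤ p)
    {v : ι → ℝ} (hv : ∀ i, (C *ᵥ v) i ≤ p * (h i - (C *ᵥ (ξ : ι → ℝ)) i)) :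
    ∃ ζ : polyhedron C h, v = p • ((ζ : ι → ℝ) - ξ) := by
  rcases hp.eq_or_lt with rfl | hp
  · exact ⟨ξ, by simpa using eq_zero_of_mulVec_nonpos hΞ ξ.2 (v := v) (by simpa using hv)⟩
  · refine ⟨⟨ξ + p⁻¹ • v, fun i => ?_⟩, ?_⟩
    · rw [Matrix.mulVec_add, Matrix.mulVec_smul, Pi.add_apply, Pi.smul_apply, smul_eq_mul]
      have := (inv_mul_le_iff₀ hp).2 (hv i)
      linarith
    · simp [smul_smul, hp.ne']

section Duality

variable {n : ℕ} {d : Fin n → ℕ} {N : (k : Fin n) → Seminorm ℝ (Fin (d k) → ℝ)}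
  {q : ℕ} {C : Matrix (Fin q) ((k : Fin n) × Fin (d k)) ℝ} {h : Fin q → ℝ}

/-- A nonpositive worst-case CVaR bounds the finite-dimensional program in which mass `p l j` of
the atom `ξ l` is moved so as to activate the `j`-th affine piece, `v l j` being the displacement
multiplied by the mass. -/
theorem primal_value_nonpos {ε : Fin n → ℝ} (hΞ : IsCompact (polyhedron C h))
    {M m : ℕ} [NeZero m] {ϑ : Fin M → ℝ} (hϑ1 : ∑ l, ϑ l = 1)
    (ξ : Fin M → polyhedron C h) (a : Fin m → BlockVec d) (β : Fin m → ℝ) {α : ℝ}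
    (hcvar : worstCaseCVaR
      (multiTransportHyperrectangle 1 N (polyhedron C h) (discreteMeasure ϑ ξ) ε)
      (fun ζ => Finset.univ.sup' Finset.univ_nonempty fun j => a j ⬝ᵥ (ζ : BlockVec d) + β j) α
      ≤ 0)
    {p : Fin M → Fin m → ℝ} {v : Fin M → Fin m → BlockVec d} (hp : ∀ l j, 0 ≤ p l j)
    (hpϑ : ∀ l, ∑ j, p l j ≤ ϑ l) (hpα : ∑ l, ∑ j, p l j = α)
    (hv : ∀ l j i, (C *ᵥ v l j) i ≤ p l j * (h i - (C *ᵥ (ξ l : BlockVec d)) i))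
    (hcost : ∀ k, ∑ l, ∑ j, N k (blockProj k (v l j)) ≤ ε k) :
    ∑ l, ∑ j, (a j ⬝ᵥ v l j + p l j * (a j ⬝ᵥ (ξ l : BlockVec d) + β j)) ≤ 0 := by
  choose ζ hζ using fun l j => exists_mem_polyhedron_smul_sub hΞ (ξ l) (hp l j) (hv l j)
  -- The index `(l, none)` carries the mass of the atom `ξ l` that stays in place.
  let w : Fin M × Option (Fin m) → ℝ := fun i => i.2.elim (ϑ i.1 - ∑ j, p i.1 j) (p i.1)
  let y : Fin M × Option (Fin m) → polyhedron C h × polyhedron C h := fun i =>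
    (ξ i.1, i.2.elim (ξ i.1) (ζ i.1))
  have hw : ∀ i, 0 ≤ w i := by
    rintro ⟨l, _ | j⟩
    exacts [sub_nonneg.2 (hpϑ l), hp l j]
  have hwrow : ∀ l, ∑ o, w (l, o) = ϑ l := fun l => by
    rw [Fintype.sum_option]
    exact sub_add_cancel _ _
  have hw1 : ∑ i, w i = 1 := by
    rw [Fintype.sum_prod_type]
    simp_rw [hwrow, hϑ1]
  let π : ProbabilityMeasure (polyhedron C h × polyhedron C h) :=
    ⟨_, isProbabilityMeasure_finsetSum_dirac hw hw1 y⟩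
  let P : ProbabilityMeasure (polyhedron C h) :=
    ⟨_, isProbabilityMeasure_finsetSum_dirac hw hw1 fun i => (y i).2⟩
  have hmem : P ∈ multiTransportHyperrectangle 1 N (polyhedron C h) (discreteMeasure ϑ ξ) ε := by
    refine ⟨π, ?_, map_finsetSum_dirac y measurable_snd, fun k => ?_⟩
    · refine (map_finsetSum_dirac y measurable_fst).trans ?_
      rw [Fintype.sum_prod_type, discreteMeasure]
      refine Finset.sum_congr rfl fun l _ => ?_
      rw [← hwrow l, ENNReal.ofReal_sum_of_nonneg fun o _ => hw _, Finset.sum_smul]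
    · refine (lintegral_finsetSum_dirac y _).trans_le ?_
      simp only [Real.rpow_one]
      simp_rw [← ENNReal.ofReal_mul (hw _)]
      rw [← ENNReal.ofReal_sum_of_nonneg fun i _ => mul_nonneg (hw i) (apply_nonneg _ _)]
      refine ENNReal.ofReal_le_ofReal (le_trans (le_of_eq ?_) (hcost k))
      rw [Fintype.sum_prod_type]
      refine Finset.sum_congr rfl fun l _ => ?_
      rw [Fintype.sum_option]
      have h0 : w (l, none) * N k (blockProj k ((y (l, none)).1 : BlockVec d) -
          blockProj k ((y (l, none)).2 : BlockVec d)) = 0 := by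
        simp [y]
      rw [h0, zero_add]
      refine Finset.sum_congr rfl fun j _ => ?_
      have h1 : blockProj k (v l j) =
          p l j • (blockProj k (ζ l j : BlockVec d) - blockProj k (ξ l : BlockVec d)) := by
        rw [hζ l j]
        rfl
      rw [h1, map_smul_eq_mul, Real.norm_of_nonneg (hp l j),
        ← map_neg_eq_map (N k) (blockProj k (ζ l j : BlockVec d) - _), neg_sub]
      rfl
  set φ : polyhedron C h → ℝ := fun ζ =>
    Finset.univ.sup' Finset.univ_nonempty fun j => a j ⬝ᵥ (ζ : BlockVec d) + β j with hφ
  have hle := (le_iSup₂ (f := fun (P : ProbabilityMeasure (polyhedron C h)) _ =>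
    ⨅ τ : ℝ, ((∫ ξ, (max (φ ξ + τ) 0 - τ * α) ∂(P : Measure (polyhedron C h)) : ℝ) : EReal))
    P hmem).trans hcvar
  rw [← EReal.coe_zero] at hle
  rw [← EReal.coe_le_coe_iff]
  refine (le_iInf fun τ => ?_).trans hle
  rw [EReal.coe_le_coe_iff]
  have hint : ∫ ξ, (max (φ ξ + τ) 0 - τ * α) ∂(P : Measure (polyhedron C h)) =
      ∑ i, w i * (max (φ (y i).2 + τ) 0 - τ * α) := integral_finsetSum_dirac hw _ _
  rw [hint]
  simp only [mul_sub, Finset.sum_sub_distrib]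
  -- Writing `α` as the total of `p` distributes `τ * α` over the moved masses. It then suffices to
  -- drop the nonnegative contribution of the unmoved mass and to bound each positive part below by
  -- one affine piece.
  rw [← Finset.sum_mul, hw1, one_mul, Fintype.sum_prod_type, le_sub_iff_add_le, ← hpα,
    Finset.mul_sum, ← Finset.sum_add_distrib]
  refine Finset.sum_le_sum fun l _ => ?_
  rw [Fintype.sum_option, Finset.mul_sum, ← Finset.sum_add_distrib]
  refine le_add_of_nonneg_of_le (mul_nonneg (hw _) (le_max_right _ _)) ?_
  refine Finset.sum_le_sum fun j _ => ?_
  have h1 : a j ⬝ᵥ v l j + p l j * (a j ⬝ᵥ (ξ l : BlockVec d) + β j) + τ * p l j =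
      p l j * (a j ⬝ᵥ (ζ l j : BlockVec d) + β j + τ) := by
    rw [hζ l j, dotProduct_smul, dotProduct_sub, smul_eq_mul]
    ring
  rw [h1]
  refine mul_le_mul_of_nonneg_left (le_trans ?_ (le_max_left _ _)) (hp l j)
  have h2 : a j ⬝ᵥ (ζ l j : BlockVec d) + β j ≤ φ (ζ l j) := by
    simp only [hφ, Finset.le_sup'_iff]
    exact ⟨j, Finset.mem_univ j, le_rfl⟩
  exact add_le_add h2 le_rfl

/-! ### Lagrange duality by separation. -/

/-- Lagrange duality for a linear objective under polyhedral constraints and an open convex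
constraint which admits a strictly feasible point. -/
theorem exists_multipliers_of_nonpos {T E ι κ : Type*} [AddCommGroup T] [Module ℝ T]
    [NormedAddCommGroup E] [NormedSpace ℝ E] [Fintype ι] [Fintype κ]
    (L : T →ₗ[ℝ] E) (V : T →ₗ[ℝ] ℝ) (f : ι → T →ₗ[ℝ] ℝ) (b : ι → ℝ) (g : κ → T →ₗ[ℝ] ℝ)
    (e : κ → ℝ) {O : Set E} (hO : IsOpen O) (hOc : Convex ℝ O) (x₀ : T)
    (hx₀ : ∀ i, f i x₀ ≤ b i) (hg₀ : ∀ j, g j x₀ = e j) (hL₀ : L x₀ ∈ O)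
    (hV : ∀ x, (∀ i, f i x ≤ b i) → (∀ j, g j x = e j) → L x ∈ O → V x ≤ 0) :
    ∃ (z : E →L[ℝ] ℝ) (u : ℝ) (y : ι → ℝ) (w : κ → ℝ), (∀ i, 0 ≤ y i) ∧
      (∀ v ∈ O, z v ≤ u) ∧
      (∀ x, V x = z (L x) + (∑ i, y i * f i x + ∑ j, w j * g j x)) ∧
      ∑ i, y i * b i + ∑ j, w j * e j + u ≤ 0 := by
  let X : Set T := {x | (∀ i, f i x ≤ b i) ∧ ∀ j, g j x = e j}
  have hX : Convex ℝ X := by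
    rintro x ⟨hx1, hx2⟩ x' ⟨hx1', hx2'⟩ s t hs ht hst
    refine ⟨fun i => ?_, fun j => ?_⟩
    · simp only [map_add, map_smul, smul_eq_mul]
      calc s * f i x + t * f i x' ≤ s * b i + t * b i :=
            add_le_add (mul_le_mul_of_nonneg_left (hx1 i) hs)
              (mul_le_mul_of_nonneg_left (hx1' i) ht)
        _ = b i := by rw [← add_mul, hst, one_mul]
    · simp only [map_add, map_smul, smul_eq_mul]
      rw [hx2, hx2', ← add_mul, hst, one_mul]
  -- The hypothesis `hV` says that the image of the polyhedral set under `(L, V)` misses the open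
  -- convex set `O × (0, ∞)`.
  obtain ⟨F, u, hFO, hFD⟩ := geometric_hahn_banach_open (hOc.prod (convex_Ioi (0 : ℝ)))
    (hO.prod isOpen_Ioi) (hX.linear_image (L.prod V)) (by
      rw [Set.disjoint_left]
      rintro y ⟨hy1, hy2⟩ ⟨x, hx, rfl⟩
      exact absurd (hV x hx.1 hx.2 hy1) (not_le.2 hy2))
  have hsplit : ∀ v r, F (v, r) = F (v, 0) + r * F (0, 1) := fun v r => by
    rw [← smul_eq_mul, ← map_smul, ← map_add]
    simp
  have hO' : ∀ v ∈ O, ∀ r > 0, F (v, 0) + r * F (0, 1) < u := fun v hv r hr => by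
    rw [← hsplit]
    exact hFO _ ⟨hv, hr⟩
  have hD' : ∀ x ∈ X, u ≤ F (L x, 0) + V x * F (0, 1) := fun x hx => by
    rw [← hsplit]
    exact hFD _ ⟨x, hx, rfl⟩
  -- The separating hyperplane is not vertical: above `L x₀ ∈ O` there are points of both sets, and
  -- a nonnegative coefficient would order them wrongly.
  have hρ : F (0, 1) < 0 := by
    by_contra! hneg
    have h1 := hD' x₀ ⟨hx₀, hg₀⟩
    have h2 := hO' _ hL₀ (|V x₀| + 1) (by positivity)
    nlinarith [le_abs_self (V x₀)]
  have hclosed : ∀ v ∈ O, F (v, 0) ≤ u := fun v hv => by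
    refine le_of_forall_pos_le_add fun r hr => ?_
    have := hO' v hv (r / (-F (0, 1))) (div_pos hr (neg_pos.2 hρ))
    have h3 : r / (-F (0, 1)) * F (0, 1) = -r := by
      field_simp [hρ.ne]
    linarith
  set ρ : ℝ := -F (0, 1) with hρdef
  have hρpos : 0 < ρ := neg_pos.2 hρ
  let z : E →L[ℝ] ℝ := ρ⁻¹ • F.comp (ContinuousLinearMap.inl ℝ E ℝ)
  have hz : ∀ v, z v = ρ⁻¹ * F (v, 0) := fun v => rfl
  -- With the coefficient of `V` normalized to one, the separation is an affine inequality on the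
  -- polyhedral set, so these constraints need no strictly feasible point.
  obtain ⟨y, w, hy, hVy, hyb⟩ := farkas_affine_eq f b g e (V - z.toLinearMap ∘ₗ L) (-(ρ⁻¹ * u)) x₀
    hx₀ hg₀ (by
      intro x hx1 hx2
      have := hD' x ⟨hx1, hx2⟩
      have h5 : ρ⁻¹ * u ≤ ρ⁻¹ * (F (L x, 0) - V x * ρ) :=
        mul_le_mul_of_nonneg_left (by rw [hρdef]; linarith) (inv_nonneg.2 hρpos.le)
      have h6 : ρ⁻¹ * (F (L x, 0) - V x * ρ) = ρ⁻¹ * F (L x, 0) - V x := by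
        field_simp
      simp only [LinearMap.sub_apply, LinearMap.comp_apply, ContinuousLinearMap.coe_coe, hz]
      linarith)
  refine ⟨z, ρ⁻¹ * u, y, w, hy, fun v hv => ?_, fun x => ?_, by linarith⟩
  · rw [hz]
    exact mul_le_mul_of_nonneg_left (hclosed v hv) (inv_nonneg.2 hρpos.le)
  · rw [← hVy x]
    simp

/-- Testing with `p = κ` and `v = G` gives a vanishing sum of squares. -/
theorem eq_zero_of_forall_sum_eq_zero {M m : ℕ} {ι : Type} [Fintype ι] (G : Fin M → Fin m → ι → ℝ)
    (κ : Fin M → Fin m → ℝ)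
    (hsum : ∀ (p : Fin M → Fin m → ℝ) (v : Fin M → Fin m → ι → ℝ),
      ∑ l, ∑ j, (G l j ⬝ᵥ v l j + κ l j * p l j) = 0) (l : Fin M) (j : Fin m) :
    G l j = 0 ∧ κ l j = 0 := by
  have hG : ∀ l j, 0 ≤ G l j ⬝ᵥ G l j := fun l j =>
    Finset.sum_nonneg fun i _ => mul_self_nonneg _
  have h0 : ∀ l j, 0 ≤ G l j ⬝ᵥ G l j + κ l j * κ l j := fun l j =>
    add_nonneg (hG l j) (mul_self_nonneg _)
  have h1 := (Finset.sum_eq_zero_iff_of_nonneg fun l _ =>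
    Finset.sum_nonneg fun j _ => h0 l j).1 (hsum κ G) l (Finset.mem_univ l)
  have h2 := (Finset.sum_eq_zero_iff_of_nonneg fun j _ => h0 l j).1 h1 j (Finset.mem_univ j)
  have h3 := (add_eq_zero_iff_of_nonneg (hG l j) (mul_self_nonneg _)).1 h2
  exact ⟨dotProduct_self_eq_zero.1 h3.1, mul_self_eq_zero.1 h3.2⟩

theorem exists_dotProduct_eq {M m : ℕ} {ι : Type} [Fintype ι] [DecidableEq ι]
    (z : (Fin M → Fin m → ι → ℝ) →ₗ[ℝ] ℝ) :
    ∃ y : Fin M → Fin m → ι → ℝ, ∀ v, z v = ∑ l, ∑ j, y l j ⬝ᵥ v l j := by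
  refine ⟨fun l j i => z (Pi.single l (Pi.single j (Pi.single i 1))), fun v => ?_⟩
  have hv : v = ∑ l, ∑ j, ∑ i, v l j i • (Pi.single l (Pi.single j (Pi.single i 1)) :
      Fin M → Fin m → ι → ℝ) := by
    ext l j i
    simp only [Finset.sum_apply, Pi.smul_apply, smul_eq_mul]
    rw [Finset.sum_eq_single l, Finset.sum_eq_single j, Finset.sum_eq_single i]
    · simp
    · intro i' _ hi
      simp [hi.symm]
    · simp
    · intro j' _ hj
      simp [hj.symm]
    · simp
    · intro l' _ hl
      simp [hl.symm]
    · simp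
  conv_lhs => rw [hv]
  simp only [map_sum, map_smul, smul_eq_mul, dotProduct]
  refine Finset.sum_congr rfl fun l _ => Finset.sum_congr rfl fun j _ =>
    Finset.sum_congr rfl fun i _ => mul_comm _ _

/-- The support function of the transport budget set is the sum over the blocks of the budget times
the largest dual norm. -/
theorem sum_mul_dualNorm_le_of_support (hN : ∀ k v, N k v = 0 → v = 0) {ε : Fin n → ℝ}
    {M m : ℕ} (z : Fin M → Fin m → BlockVec d) {u : ℝ}
    (hz : ∀ v : Fin M → Fin m → BlockVec d,
      (∀ k, 0 < ε k → ∑ l, ∑ j, N k (blockProj k (v l j)) < ε k) →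
        ∑ l, ∑ j, z l j ⬝ᵥ v l j ≤ u)
    (sel : Fin n → Fin M × Fin m) :
    ∑ k, dualNorm (N k) (blockProj k (z (sel k).1 (sel k).2)) * ε k ≤ u := by
  choose vs hvs hvseq _ using fun k =>
    exists_dualNorm_eq (hN k) (blockProj k (z (sel k).1 (sel k).2))
  have key : ∀ t : ℝ, 0 < t → t < 1 →
      t * ∑ k, dualNorm (N k) (blockProj k (z (sel k).1 (sel k).2)) * ε k ≤ u := by
    intro t ht ht1
    -- For each block `k`, a fraction `t` of the budget is spent on the single index `sel k`, in a
    -- direction attaining the dual norm. Taking `t < 1` keeps the positive budgets strict; then `t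
    -- → 1`.
    let v : Fin M → Fin m → BlockVec d := fun l j i =>
      if (l, j) = sel i.1 then (t * ε i.1) * vs i.1 i.2 else 0
    have hv : ∀ l j k, blockProj k (v l j) =
        if (l, j) = sel k then (t * ε k) • vs k else 0 := fun l j k => by
      ext i
      simp only [blockProj, v]
      split_ifs <;> rfl
    have hzv := hz v (fun k hk => by
      simp only [hv]
      rw [← Fintype.sum_prod_type' (f := fun l j =>
        N k (if (l, j) = sel k then (t * ε k) • vs k else 0))]
      simp only [Prod.mk.eta, apply_ite (N k), map_zero, Finset.sum_ite_eq', Finset.mem_univ,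
        if_true, map_smul_eq_mul]
      rw [Real.norm_of_nonneg (by positivity)]
      have := mul_le_mul_of_nonneg_left (hvs k) (by positivity : 0 ≤ t * ε k)
      nlinarith)
    convert hzv using 1
    simp only [dotProduct_eq_sum_blockProj, hv]
    rw [← Fintype.sum_prod_type' (f := fun l j => ∑ k, blockProj k (z l j) ⬝ᵥ
        (if (l, j) = sel k then (t * ε k) • vs k else 0)), Finset.sum_comm, Finset.mul_sum]
    refine Finset.sum_congr rfl fun k _ => ?_
    rw [Finset.sum_eq_single (sel k)]
    · rw [if_pos rfl, dotProduct_smul, hvseq, smul_eq_mul]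
      ring
    · intro i _ hi
      rw [if_neg hi, dotProduct_zero]
    · simp
  set S := ∑ k, dualNorm (N k) (blockProj k (z (sel k).1 (sel k).2)) * ε k
  have hlim : Filter.Tendsto (fun t : ℝ => t * S) (nhdsWithin 1 (Set.Iio 1)) (nhds (1 * S)) :=
    (continuous_id.mul continuous_const).continuousWithinAt
  rw [one_mul] at hlim
  refine le_of_tendsto hlim ?_
  filter_upwards [Ioo_mem_nhdsLT (zero_lt_one' ℝ)] with t ht
  exact key t ht.1 ht.2

/-- Strong duality with attained multipliers. -/
theorem exists_multipliers_of_primal (hN : ∀ k v, N k v = 0 → v = 0) {ε : Fin n → ℝ}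
    (hε : ∀ k, 0 ≤ ε k) {M m : ℕ} [NeZero M] [NeZero m] {ϑ : Fin M → ℝ} (hϑ : ∀ l, 0 ≤ ϑ l)
    (hϑ1 : ∑ l, ϑ l = 1) (ξ : Fin M → polyhedron C h) (a : Fin m → BlockVec d) (β : Fin m → ℝ)
    {α : ℝ} (hα0 : 0 ≤ α) (hα1 : α ≤ 1)
    (hprimal : ∀ (p : Fin M → Fin m → ℝ) (v : Fin M → Fin m → BlockVec d), (∀ l j, 0 ≤ p l j) →
      (∀ l, ∑ j, p l j ≤ ϑ l) → ∑ l, ∑ j, p l j = α →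
      (∀ l j i, (C *ᵥ v l j) i ≤ p l j * (h i - (C *ᵥ (ξ l : BlockVec d)) i)) →
      (∀ k, ∑ l, ∑ j, N k (blockProj k (v l j)) ≤ ε k) →
      ∑ l, ∑ j, (a j ⬝ᵥ v l j + p l j * (a j ⬝ᵥ (ξ l : BlockVec d) + β j)) ≤ 0) :
    ∃ (τ : ℝ) (lam : Fin n → ℝ) (s : Fin M → ℝ) (η : Fin M → Fin m → Fin q → ℝ),
      (∀ k, 0 ≤ lam k) ∧ (∀ l, 0 ≤ s l) ∧ (∀ l j i, 0 ≤ η l j i) ∧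
      lam ⬝ᵥ ε + ∑ l, ϑ l * s l ≤ τ * α ∧
      (∀ l j, β j + τ + (a j - Cᵀ *ᵥ η l j) ⬝ᵥ (ξ l : BlockVec d) + η l j ⬝ᵥ h ≤ s l) ∧
      ∀ l j k, dualNorm (N k) (blockProj k (a j - Cᵀ *ᵥ η l j)) ≤ lam k := by
  classical
  let pr : Fin M → Fin m → (Fin M → Fin m → ℝ) × (Fin M → Fin m → BlockVec d) →ₗ[ℝ]
       ℝ := fun l j =>
    LinearMap.proj j ∘ₗ LinearMap.proj l ∘ₗ LinearMap.fst ℝ (Fin M → Fin m → ℝ)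
      (Fin M → Fin m → BlockVec d)
  let vec : Fin M → Fin m → (Fin M → Fin m → ℝ) × (Fin M → Fin m → BlockVec d) →ₗ[ℝ]
       BlockVec d := fun l j =>
    LinearMap.proj j ∘ₗ LinearMap.proj l ∘ₗ LinearMap.snd ℝ (Fin M → Fin m → ℝ)
      (Fin M → Fin m → BlockVec d)
  let slack : Fin M → Fin q → ℝ := fun l i => h i - (C *ᵥ (ξ l : BlockVec d)) i
  let f : (Fin M × Fin m) ⊕ Fin M ⊕ (Fin M × Fin m × Fin q) →
      (Fin M → Fin m → ℝ) × (Fin M → Fin m → BlockVec d) →ₗ[ℝ] ℝ :=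
    Sum.elim (fun i => -pr i.1 i.2) (Sum.elim (fun l => ∑ j, pr l j) fun i =>
      LinearMap.proj i.2.2 ∘ₗ C.mulVecLin ∘ₗ vec i.1 i.2.1 - slack i.1 i.2.2 • pr i.1 i.2.1)
  -- A block with `ε k = 0` admits no strictly feasible point, so its budget is encoded as the
  -- linear equations that the block of `v` vanish. For the other blocks the equation is `0 = 0`.
  let g : Option (Fin M × Fin m × ((k : Fin n) × Fin (d k))) →
      (Fin M → Fin m → ℝ) × (Fin M → Fin m → BlockVec d) →ₗ[ℝ] ℝ := fun o =>
    o.elim (∑ l, ∑ j, pr l j) fun i =>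
      (if ε i.2.2.1 = 0 then (1 : ℝ) else 0) • (LinearMap.proj i.2.2 ∘ₗ vec i.1 i.2.1)
  let V : (Fin M → Fin m → ℝ) × (Fin M → Fin m → BlockVec d) →ₗ[ℝ] ℝ := ∑ l, ∑ j, (dotProductBilin ℝ ℝ (a j) ∘ₗ vec l j +
    (a j ⬝ᵥ (ξ l : BlockVec d) + β j) • pr l j)
  let O : Set (Fin M → Fin m → BlockVec d) := ⋂ k, {v | 0 < ε k → ∑ l, ∑ j, N k (blockProj k (v l j)) < ε k}
  have hOo : IsOpen O := by
    refine isOpen_iInter_of_finite fun k => ?_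
    by_cases hk : 0 < ε k
    · simp only [hk, true_imp_iff]
      refine isOpen_lt ?_ continuous_const
      refine continuous_finsetSum _ fun l _ => continuous_finsetSum _ fun j _ => ?_
      exact (N k).continuous_pi_fin.comp ((continuous_blockProj k).comp (by fun_prop))
    · simp [hk]
  have hOc : Convex ℝ O := by
    refine convex_iInter fun k => ?_
    intro v hv v' hv' s t hs ht hst hk
    have h1 := hv hk
    have h2 := hv' hk
    have hle : ∑ l, ∑ j, N k (blockProj k ((s • v + t • v') l j)) ≤
        s * ∑ l, ∑ j, N k (blockProj k (v l j)) + t * ∑ l, ∑ j, N k (blockProj k (v' l j)) := by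
      simp only [Finset.mul_sum, ← Finset.sum_add_distrib]
      refine Finset.sum_le_sum fun l _ => Finset.sum_le_sum fun j _ => ?_
      exact (N k).convexOn.2 (Set.mem_univ _) (Set.mem_univ _) hs ht hst
    exact hle.trans_lt ((convex_Iio (ε k)) h1 h2 hs ht hst)
  have hslack : ∀ l i, 0 ≤ slack l i := fun l i => sub_nonneg.2 ((ξ l).2 i)
  have hm : (m : ℝ) ≠ 0 := Nat.cast_ne_zero.2 (NeZero.ne m)
  have hf1 : ∀ l j x, f (Sum.inl (l, j)) x = -x.1 l j := fun _ _ _ => rfl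
  have hf2 : ∀ l x, f (Sum.inr (Sum.inl l)) x = ∑ j, x.1 l j := fun _ _ => by simp [f, pr]
  have hf3 : ∀ l j i x, f (Sum.inr (Sum.inr (l, j, i))) x =
      (C *ᵥ x.2 l j) i - slack l i * x.1 l j := fun _ _ _ _ => rfl
  have hg1 : ∀ x, g none x = ∑ l, ∑ j, x.1 l j := fun _ => by simp [g, pr]
  have hg2 : ∀ l j i x, g (some (l, j, i)) x = (if ε i.1 = 0 then 1 else 0) * x.2 l j i :=
    fun _ _ _ _ => rfl
  have hVx : ∀ x, V x = ∑ l, ∑ j, (a j ⬝ᵥ x.2 l j +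
      (a j ⬝ᵥ (ξ l : BlockVec d) + β j) * x.1 l j) := fun x => by
    simp [V, pr, vec, dotProductBilin]
  obtain ⟨z, u, y, w, hy, hzu, hid, hbud⟩ := exists_multipliers_of_nonpos
    (LinearMap.snd ℝ (Fin M → Fin m → ℝ)
      (Fin M → Fin m → BlockVec d)) V f (Sum.elim (fun _ => 0) (Sum.elim ϑ fun _ => 0)) g
    -- The strictly feasible point moves no mass and splits `α * ϑ l` evenly over the `m` pieces.
    (fun o => o.elim α fun _ => 0) hOo hOc (fun l _ => α * ϑ l / m, 0)
    (by
      have hnn : ∀ l, 0 ≤ α * ϑ l / m := fun l =>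
        div_nonneg (mul_nonneg hα0 (hϑ l)) (Nat.cast_nonneg m)
      rintro (⟨l, j⟩ | l | ⟨l, j, i⟩)
      · rw [hf1]
        exact neg_nonpos.2 (hnn l)
      · rw [hf2]
        simpa [mul_div_cancel₀ _ hm] using mul_le_of_le_one_left (hϑ l) hα1
      · rw [hf3]
        simpa using mul_nonneg (hslack l i) (hnn l))
    (by
      rintro (_ | ⟨l, j, i⟩)
      · rw [hg1]
        simp [mul_div_cancel₀ _ hm, ← Finset.mul_sum, hϑ1]
      · rw [hg2]
        simp)
    (by
      refine Set.mem_iInter.2 fun k hk => ?_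
      have h0 : blockProj k (0 : BlockVec d) = 0 := rfl
      simpa [h0] using hk)
    (by
      rintro ⟨p, v⟩ hf hg hO
      rw [hVx]
      refine (le_of_eq ?_).trans (hprimal p v (fun l j => ?_) (fun l => ?_) ?_
        (fun l j i => ?_) fun k => ?_)
      · simp only [mul_comm]
      · have := hf (Sum.inl (l, j))
        rw [hf1] at this
        exact neg_nonpos.1 this
      · have := hf (Sum.inr (Sum.inl l))
        rwa [hf2] at this
      · have := hg none
        rwa [hg1] at this
      · have := hf (Sum.inr (Sum.inr (l, j, i)))
        rw [hf3, mul_comm] at this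
        exact sub_nonpos.1 this
      · rcases (hε k).eq_or_lt with hk | hk
        · have h0 : ∀ l j, blockProj k (v l j) = 0 := fun l j => by
            ext i
            have := hg (some (l, j, ⟨k, i⟩))
            rw [hg2, if_pos hk.symm, one_mul] at this
            exact this
          simp [h0, ← hk]
        · exact (Set.mem_iInter.1 hO k hk).le)
  obtain ⟨zv, hzv⟩ := exists_dotProduct_eq z.toLinearMap
  simp only [ContinuousLinearMap.coe_coe] at hzv
  let η : Fin M → Fin m → Fin q → ℝ := fun l j i => y (Sum.inr (Sum.inr (l, j, i)))
  let s : Fin M → ℝ := fun l => y (Sum.inr (Sum.inl l))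
  let w' : Fin M → Fin m → BlockVec d := fun l j i =>
    w (some (l, j, i)) * (if ε i.1 = 0 then 1 else 0)
  -- The multiplier identity holds for all `(p, v)`, so the coefficients of each `v l j` and `p l j`
  -- can be compared.
  have hzero := eq_zero_of_forall_sum_eq_zero
    (fun l j => a j - zv l j - Cᵀ *ᵥ η l j - w' l j)
    (fun l j => a j ⬝ᵥ (ξ l : BlockVec d) + β j + y (Sum.inl (l, j)) -
      s l - w none + η l j ⬝ᵥ slack l) (by
      intro p v
      have hterm : ∀ l j, (a j - zv l j - Cᵀ *ᵥ η l j - w' l j) ⬝ᵥ v l j +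
          (a j ⬝ᵥ (ξ l : BlockVec d) + β j + y (Sum.inl (l, j)) - s l - w none +
            η l j ⬝ᵥ slack l) * p l j =
          (a j ⬝ᵥ v l j + (a j ⬝ᵥ (ξ l : BlockVec d) + β j) * p l j) - zv l j ⬝ᵥ v l j -
          y (Sum.inl (l, j)) * -p l j - s l * p l j -
          ∑ i, η l j i * ((C *ᵥ v l j) i - slack l i * p l j) - w none * p l j -
          ∑ i, w (some (l, j, i)) * ((if ε i.1 = 0 then 1 else 0) * v l j i) := by
        intro l j
        have h1 : (Cᵀ *ᵥ η l j) ⬝ᵥ v l j = ∑ i, η l j i * (C *ᵥ v l j) i := by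
          rw [Matrix.mulVec_transpose, ← Matrix.dotProduct_mulVec]
          rfl
        have h2 : w' l j ⬝ᵥ v l j =
            ∑ i, w (some (l, j, i)) * ((if ε i.1 = 0 then 1 else 0) * v l j i) :=
          Finset.sum_congr rfl fun i _ => mul_assoc _ _ _
        have h3 : (η l j ⬝ᵥ slack l) * p l j = ∑ i, η l j i * (slack l i * p l j) := by
          rw [dotProduct, Finset.sum_mul]
          exact Finset.sum_congr rfl fun i _ => mul_assoc _ _ _
        simp only [sub_dotProduct, mul_sub, Finset.sum_sub_distrib, h1, h2, ← h3]
        ring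
      have hidv := hid (p, v)
      simp only [Fintype.sum_sum_type, Fintype.sum_prod_type, Fintype.sum_option, hVx, hf1, hf2,
        hf3, hg1, hg2, LinearMap.snd_apply, hzv, Finset.mul_sum] at hidv
      simp only [hterm, Finset.sum_sub_distrib] at hidv ⊢
      linarith)
  -- The smallest `λ` allowed by the dual norm constraints.
  let lam : Fin n → ℝ := fun k => Finset.univ.sup' Finset.univ_nonempty fun i : Fin M × Fin m =>
    dualNorm (N k) (blockProj k (a i.2 - Cᵀ *ᵥ η i.1 i.2))
  have hlam : ∀ l j k, dualNorm (N k) (blockProj k (a j - Cᵀ *ᵥ η l j)) ≤ lam k := fun l j k => by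
    simp only [lam, Finset.le_sup'_iff]
    exact ⟨(l, j), Finset.mem_univ _, le_rfl⟩
  have hsel : ∀ k, ∃ i : Fin M × Fin m,
      lam k = dualNorm (N k) (blockProj k (a i.2 - Cᵀ *ᵥ η i.1 i.2)) := fun k => by
    obtain ⟨i, _, hi⟩ := Finset.exists_mem_eq_sup' Finset.univ_nonempty
      fun i : Fin M × Fin m => dualNorm (N k) (blockProj k (a i.2 - Cᵀ *ᵥ η i.1 i.2))
    exact ⟨i, hi⟩
  choose sel hsel using hsel
  have hcost := sum_mul_dualNorm_le_of_support hN zv (ε := ε) (u := u)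
    (fun v hv => hzv v ▸ hzu v (Set.mem_iInter.2 hv)) sel
  have hlamε : lam ⬝ᵥ ε ≤ u := by
    refine (Finset.sum_le_sum fun k _ => le_of_eq ?_).trans hcost
    -- If `ε k = 0`, the free multipliers `w'` may make the blocks differ, but the term has weight
    -- zero; otherwise `w'` vanishes on the block.
    by_cases hk : ε k = 0
    · simp [hk]
    · have hblock : blockProj k (a (sel k).2 - Cᵀ *ᵥ η (sel k).1 (sel k).2) =
          blockProj k (zv (sel k).1 (sel k).2) := by
        ext i
        have := congrFun (hzero (sel k).1 (sel k).2).1 ⟨k, i⟩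
        simp only [Pi.sub_apply, Pi.zero_apply, w', if_neg hk, mul_zero] at this
        simp only [blockProj, Pi.sub_apply]
        linarith
      rw [hsel, hblock]
  refine ⟨-w none, lam, s, η, fun k => ?_, fun l => hy _, fun l j i => hy _, ?_, fun l j => ?_,
    hlam⟩
  · rw [hsel]
    exact dualNorm_nonneg (hN k) _
  · simp only [Fintype.sum_sum_type, Fintype.sum_option, Sum.elim_inl, Sum.elim_inr, mul_zero,
      Finset.sum_const_zero, Option.elim_none, Option.elim_some, add_zero, zero_add] at hbud
    have : ∑ l, ϑ l * s l = ∑ l, y (Sum.inr (Sum.inl l)) * ϑ l :=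
      Finset.sum_congr rfl fun l _ => mul_comm _ _
    linarith
  -- The multiplier of `p l j ≥ 0` is the slack in the epigraph inequality.
  · have h1 := (hzero l j).2
    have h2 : η l j ⬝ᵥ slack l = η l j ⬝ᵥ h - (Cᵀ *ᵥ η l j) ⬝ᵥ (ξ l : BlockVec d) := by
      rw [Matrix.mulVec_transpose, ← Matrix.dotProduct_mulVec, ← dotProduct_sub]
      rfl
    have h3 := hy (Sum.inl (l, j))
    rw [sub_dotProduct]
    linarith

end Duality

/-! ### Convexity of the constraints and the final equivalence. -/

theorem reformConstraint_convexOn {n : ℕ} {d : Fin n → ℕ} {q M ℓ m : ℕ}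
    {N : (k : Fin n) → Seminorm ℝ (Fin (d k) → ℝ)} (hN : ∀ k v, N k v = 0 → v = 0)
    (ε : Fin n → ℝ) (C : Matrix (Fin q) ((k : Fin n) × Fin (d k)) ℝ) (h : Fin q → ℝ)
    (ϑ : Fin M → ℝ) (ξ : Fin M → BlockVec d)
    (A : Fin m → Matrix (Fin ℓ) ((k : Fin n) × Fin (d k)) ℝ)
    {b : Fin m → (Fin ℓ → ℝ) → ℝ} (hb : ∀ j, ConvexOn ℝ Set.univ (b j)) (α : ℝ)
    (c : ConstraintLabel n M m q) :
    ConvexOn ℝ Set.univ (reformConstraint N ε C h ϑ ξ A b α c) := by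
  refine ⟨convex_univ, ?_⟩
  rintro ⟨x, τ, lam, s, η⟩ _ ⟨x', τ', lam', s', η'⟩ _ t t' ht ht' htt
  have hlin : ∀ l j, (A j)ᵀ *ᵥ (t • x + t' • x') - Cᵀ *ᵥ (t • η l j + t' • η' l j) =
      t • ((A j)ᵀ *ᵥ x - Cᵀ *ᵥ η l j) + t' • ((A j)ᵀ *ᵥ x' - Cᵀ *ᵥ η' l j) := fun l j => by
    simp only [Matrix.mulVec_add, Matrix.mulVec_smul, smul_sub]
    abel
  cases c with
  | budget =>
    simp only [reformConstraint, Prod.smul_mk, add_dotProduct, smul_dotProduct,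
      Pi.add_apply, Pi.smul_apply, smul_eq_mul, mul_add, Finset.sum_add_distrib, mul_left_comm _ t,
      mul_left_comm _ t', ← Finset.mul_sum]
    apply le_of_eq
    ring
  | epigraph l j =>
    have hbj := (hb j).2 (Set.mem_univ x) (Set.mem_univ x') ht ht' htt
    simp only [reformConstraint, Prod.smul_mk, Pi.add_apply, Pi.smul_apply, hlin]
    simp only [add_dotProduct, smul_dotProduct, smul_eq_mul] at hbj ⊢
    linarith
  | dualBound l j k =>
    have hd := (dualNorm_convexOn (hN k)).2
      (Set.mem_univ (blockProj k ((A j)ᵀ *ᵥ x - Cᵀ *ᵥ η l j)))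
      (Set.mem_univ (blockProj k ((A j)ᵀ *ᵥ x' - Cᵀ *ᵥ η' l j))) ht ht' htt
    have hproj : ∀ y y' : BlockVec d, blockProj k (t • y + t' • y') =
      t • blockProj k y + t' • blockProj k y' := fun _ _ => rfl
    simp only [reformConstraint, Prod.smul_mk, Pi.add_apply, Pi.smul_apply, hlin,
      hproj]
    simp only [smul_eq_mul] at hd ⊢
    linarith
  | lamNonneg k =>
    simp only [reformConstraint, Prod.smul_mk, Pi.add_apply, Pi.smul_apply,
      smul_eq_mul]
    linarith
  | sNonneg l =>
    simp only [reformConstraint, Prod.smul_mk, Pi.add_apply, Pi.smul_apply,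
      smul_eq_mul]
    linarith
  | etaNonneg l j i =>
    simp only [reformConstraint, Prod.smul_mk, Pi.add_apply, Pi.smul_apply,
      smul_eq_mul]
    linarith

/-- The worst-case CVaR constraint holds at `x` if and only if the reformulated constraints can be
satisfied. -/
theorem worstCaseCVaR_nonpos_iff {n : ℕ} {d : Fin n → ℕ}
    {N : (k : Fin n) → Seminorm ℝ (Fin (d k) → ℝ)} (hN : ∀ k v, N k v = 0 → v = 0)
    {ε : Fin n → ℝ} (hε : ∀ k, 0 ≤ ε k)
    {q : ℕ} {C : Matrix (Fin q) ((k : Fin n) × Fin (d k)) ℝ} {h : Fin q → ℝ}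
    (hΞ : IsCompact (polyhedron C h))
    {M : ℕ} {ϑ : Fin M → ℝ} (hϑ : ∀ l, 0 ≤ ϑ l) (hϑ1 : ∑ l, ϑ l = 1)
    (ξ : Fin M → polyhedron C h) {ℓ m : ℕ} [NeZero m]
    (A : Fin m → Matrix (Fin ℓ) ((k : Fin n) × Fin (d k)) ℝ)
    (b : Fin m → (Fin ℓ → ℝ) → ℝ) {α : ℝ} (hα0 : 0 < α) (hα1 : α < 1) (x : Fin ℓ → ℝ) :
    worstCaseCVaR (multiTransportHyperrectangle 1 N (polyhedron C h) (discreteMeasure ϑ ξ) ε)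
        (fun ζ => maxAffine A b x ζ) α ≤ 0 ↔
      ∃ w : AuxVars n M m q,
        ∀ c, reformConstraint N ε C h ϑ (fun l => ξ l) A b α c (x, w) ≤ 0 := by
  have : NeZero M := ⟨by rintro rfl; simp at hϑ1⟩
  simp only [maxAffine_eq]
  constructor
  · intro hx
    obtain ⟨τ, lam, s, η, hlam, hs, hη, hbudget, hepi, hdual⟩ :=
      exists_multipliers_of_primal hN hε hϑ hϑ1 ξ (fun j => (A j)ᵀ *ᵥ x) (fun j => b j x)
        hα0.le hα1.le fun p v hp hpϑ hpα hv hcost =>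
          primal_value_nonpos hΞ hϑ1 ξ _ _ hx hp hpϑ hpα hv hcost
    refine ⟨(τ, lam, s, η), fun c => ?_⟩
    cases c with
    | budget => exact sub_nonpos.2 hbudget
    | epigraph l j => exact sub_nonpos.2 (hepi l j)
    | dualBound l j k => exact sub_nonpos.2 (hdual l j k)
    | lamNonneg k => exact neg_nonpos.2 (hlam k)
    | sNonneg l => exact neg_nonpos.2 (hs l)
    | etaNonneg l j i => exact neg_nonpos.2 (hη l j i)
  · rintro ⟨⟨τ, lam, s, η⟩, hc⟩
    exact worstCaseCVaR_nonpos_of_multipliers hN hε hΞ hϑ ξ _ _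
      (fun k => neg_nonpos.1 (hc (.lamNonneg k))) (fun l => neg_nonpos.1 (hc (.sNonneg l)))
      (fun l j i => neg_nonpos.1 (hc (.etaNonneg l j i))) (sub_nonpos.1 (hc .budget))
      (fun l j => sub_nonpos.1 (hc (.epigraph l j)))
      fun l j k => sub_nonpos.1 (hc (.dualBound l j k))

theorem mainTheorem10 {n : ℕ} (d : Fin n → ℕ)
    (N : (k : Fin n) → Seminorm ℝ (Fin (d k) → ℝ)) (hN : ∀ k v, N k v = 0 → v = 0)
    (ε : Fin n → ℝ) (hε : ∀ k, 0 ≤ ε k)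
    {q : ℕ} (C : Matrix (Fin q) ((k : Fin n) × Fin (d k)) ℝ) (h : Fin q → ℝ)
    (hΞ : IsCompact (polyhedron C h))
    {M : ℕ} (ϑ : Fin M → ℝ) (hϑ : ∀ l, 0 ≤ ϑ l) (hϑ1 : ∑ l, ϑ l = 1)
    (ξ : Fin M → polyhedron C h)
    {ℓ : ℕ} (𝒳 : Set (Fin ℓ → ℝ)) (h𝒳closed : IsClosed 𝒳) (h𝒳convex : Convex ℝ 𝒳) :
    -- a single constraint: characterization of its feasible set by convex constraints
    (∀ (m : ℕ) [NeZero m] (A : Fin m → Matrix (Fin ℓ) ((k : Fin n) × Fin (d k)) ℝ)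
        (b : Fin m → (Fin ℓ → ℝ) → ℝ) (α : ℝ),
        (∀ j, ConvexOn ℝ Set.univ (b j)) → 0 < α → α < 1 →
      cvarFeasibleSet N (polyhedron C h) (discreteMeasure ϑ ξ) ε 𝒳 (maxAffine A b) α =
          {x ∈ 𝒳 | ∃ w : AuxVars n M m q,
            ∀ c, reformConstraint N ε C h ϑ (fun l => ξ l) A b α c (x, w) ≤ 0} ∧
        ∀ c, ConvexOn ℝ Set.univ (reformConstraint N ε C h ϑ (fun l => ξ l) A b α c)) ∧
    -- the problem with several constraints: equivalence with a convex problem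
    (∀ (I m : ℕ) [NeZero m] (A : Fin I → Fin m → Matrix (Fin ℓ) ((k : Fin n) × Fin (d k)) ℝ)
        (b : Fin I → Fin m → (Fin ℓ → ℝ) → ℝ) (α : Fin I → ℝ) (g : Fin ℓ → ℝ),
        (∀ i j, ConvexOn ℝ Set.univ (b i j)) → (∀ i, 0 < α i ∧ α i < 1) →
      ∀ (original : Set (Fin ℓ → ℝ))
        (reformulated : Set ((Fin ℓ → ℝ) × (Fin I → AuxVars n M m q))),
        original = {x ∈ 𝒳 | ∀ i, worstCaseCVaR
            (multiTransportHyperrectangle 1 N (polyhedron C h) (discreteMeasure ϑ ξ) ε)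
            (fun ζ => maxAffine (A i) (b i) x ζ) (α i) ≤ 0} →
        reformulated = {v | v.1 ∈ 𝒳 ∧ ∀ i c,
            reformConstraint N ε C h ϑ (fun l => ξ l) (A i) (b i) (α i) c (v.1, v.2 i) ≤ 0} →
      Prod.fst '' reformulated = original ∧
      (⨅ x ∈ original, ((g ⬝ᵥ x : ℝ) : EReal)) =
        (⨅ v ∈ reformulated, ((g ⬝ᵥ v.1 : ℝ) : EReal)) ∧
      (∀ x, (x ∈ original ∧ IsMinOn (fun y => g ⬝ᵥ y) original x) ↔
        ∃ w, (x, w) ∈ reformulated ∧ IsMinOn (fun v => g ⬝ᵥ v.1) reformulated (x, w)) ∧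
      Convex ℝ reformulated ∧
      ∀ i c, ConvexOn ℝ Set.univ
        (fun v : (Fin ℓ → ℝ) × (Fin I → AuxVars n M m q) =>
          reformConstraint N ε C h ϑ (fun l => ξ l) (A i) (b i) (α i) c (v.1, v.2 i))) := by
  constructor
  · intro m _ A b α hb hα0 hα1
    refine ⟨?_, reformConstraint_convexOn hN ε C h ϑ _ A hb α⟩
    ext x
    exact and_congr_right fun _ => worstCaseCVaR_nonpos_iff hN hε hΞ hϑ hϑ1 ξ A b hα0 hα1 x
  · rintro I m _ A b α g hb hα original reformulated rfl rfl
    have hconv : ∀ i c, ConvexOn ℝ Set.univ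
        (fun v : (Fin ℓ → ℝ) × (Fin I → AuxVars n M m q) =>
          reformConstraint N ε C h ϑ (fun l => ξ l) (A i) (b i) (α i) c (v.1, v.2 i)) :=
      fun i c => by
        let L : (Fin ℓ → ℝ) × (Fin I → AuxVars n M m q) →ₗ[ℝ] (Fin ℓ → ℝ) × AuxVars n M m q :=
          (LinearMap.fst ℝ _ _).prod
            ((LinearMap.proj i : (Fin I → AuxVars n M m q) →ₗ[ℝ] _) ∘ₗ LinearMap.snd ℝ _ _)
        exact (reformConstraint_convexOn hN ε C h ϑ (fun l => ξ l) (A i) (hb i) (α i)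
          c).comp_linearMap L
    have himage : Prod.fst '' {v : (Fin ℓ → ℝ) × (Fin I → AuxVars n M m q) | v.1 ∈ 𝒳 ∧ ∀ i c,
        reformConstraint N ε C h ϑ (fun l => ξ l) (A i) (b i) (α i) c (v.1, v.2 i) ≤ 0} =
        {x ∈ 𝒳 | ∀ i, worstCaseCVaR
            (multiTransportHyperrectangle 1 N (polyhedron C h) (discreteMeasure ϑ ξ) ε)
            (fun ζ => maxAffine (A i) (b i) x ζ) (α i) ≤ 0} := by
      ext x
      have hiff := fun i =>
        worstCaseCVaR_nonpos_iff hN hε hΞ hϑ hϑ1 ξ (A i) (b i) (hα i).1 (hα i).2 x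
      constructor
      · rintro ⟨⟨x, w⟩, ⟨hx, hw⟩, rfl⟩
        exact ⟨hx, fun i => (hiff i).2 ⟨w i, hw i⟩⟩
      · rintro ⟨hx, hw⟩
        -- The auxiliary variables are chosen independently for each constraint, all with the same
        -- `x`.
        choose w hw using fun i => (hiff i).1 (hw i)
        exact ⟨(x, w), ⟨hx, hw⟩, rfl⟩
    refine ⟨himage, ?_, fun x => ?_, ?_, hconv⟩
    · rw [← himage, iInf_image]
    · rw [← himage]
      constructor
      · rintro ⟨⟨⟨_, w⟩, hw, rfl⟩, hmin⟩
        exact ⟨w, hw, fun v hv => hmin ⟨v, hv, rfl⟩⟩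
      · rintro ⟨w, hw, hmin⟩
        refine ⟨⟨(x, w), hw, rfl⟩, ?_⟩
        rintro _ ⟨v, hv, rfl⟩
        exact hmin hv
    · rintro v ⟨hv, hvc⟩ v' ⟨hv', hvc'⟩ s t hs ht hst
      refine ⟨h𝒳convex hv hv' hs ht hst, fun i c => ?_⟩
      exact (((hconv i c).convex_le 0) ⟨Set.mem_univ _, hvc i c⟩ ⟨Set.mem_univ _, hvc' i c⟩
        hs ht hst).2
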